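/- There are functions $W,H\colon\mathbb{N}\to\mathbb{N}$ with $W(n)=O(n^2)$ and $H(n)=O(n^{1.58})$ such that every finite tree $T$ with $n$ vertices and $e$ edges ($e=n-1$) admits a crossing-free straight-line drawing on a $W(n)\times H(n)$ integer grid that uses at most $\lceil 3e/4\rceil$ segments. That is, the vertices can be placed at distinct points of $\{0,\dots,W(n)-1\}\times\{0,\dots,H(n)-1\}$ so that, with every edge drawn as the straight-line segment between its endpoints, no edge contains a vertex other than its endpoints, two distinct edges meet at most in a common endpoint, and there are at most $\lceil 3e/4\rceil$ nondegenerate line segments, each contained in the union of the drawn edges, such that every edge lies on one of them (so one segment may represent several collinear edges). -/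

import Mathlib

open scoped Asymptotics

namespace GridDrawing

/-- The point of the plane given by an integer grid point. -/
def toPlane (z : ℤ × ℤ) : ℝ × ℝ := ((z.1 : ℝ), (z.2 : ℝ))

/-- The closed straight-line segment joining the positions of `u` and `v`. -/
def edgeSegment {V : Type*} (p : V → ℤ × ℤ) (u v : V) : Set (ℝ × ℝ) :=
  segment ℝ (toPlane (p u)) (toPlane (p v))

/-- The set of points of the plane covered by the edges of `G`, drawn straight-line with the
vertices at the positions `p`. -/
def drawnEdges {V : Type*} (G : SimpleGraph V) (p : V → ℤ × ℤ) : Set (ℝ × ℝ) :=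
  {q | ∃ u v, G.Adj u v ∧ q ∈ edgeSegment p u v}

/-- Placing the vertices of `G` at the positions `p` and drawing edges straight-line gives a
crossing-free drawing: distinct vertices have distinct positions, an edge contains no vertex other
than its endpoints, and two distinct edges meet at most in a common endpoint. -/
structure IsCrossingFree {V : Type*} (G : SimpleGraph V) (p : V → ℤ × ℤ) : Prop where
  injective : Function.Injective p
  eq_or_eq_of_mem_edge : ∀ u v w, G.Adj u v → toPlane (p w) ∈ edgeSegment p u v → w = u ∨ w = v
  exists_common_endpoint : ∀ u v x y, G.Adj u v → G.Adj x y → s(u, v) ≠ s(x, y) →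
    ∀ q, q ∈ edgeSegment p u v → q ∈ edgeSegment p x y →
      ∃ w, w ∈ s(u, v) ∧ w ∈ s(x, y) ∧ q = toPlane (p w)

/-- The straight-line drawing of `G` given by `p` uses at most `k` segments: there are at most `k`
nondegenerate line segments, all contained in the drawing, such that every edge lies on one of
them. -/
def UsesAtMostSegments {V : Type*} (G : SimpleGraph V) (p : V → ℤ × ℤ) (k : ℕ) : Prop :=
  ∃ S : Finset (Set (ℝ × ℝ)), S.card ≤ k ∧
    (∀ s ∈ S, s ⊆ drawnEdges G p ∧ ∃ a b : ℝ × ℝ, a ≠ b ∧ s = segment ℝ a b) ∧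
    ∀ u v, G.Adj u v → ∃ s ∈ S, edgeSegment p u v ⊆ s

/-- All positions lie on the integer grid with `W` columns and `H` rows. -/
def OnGrid {V : Type*} (p : V → ℤ × ℤ) (W H : ℕ) : Prop :=
  ∀ v, 0 ≤ (p v).1 ∧ (p v).1 < W ∧ 0 ≤ (p v).2 ∧ (p v).2 < H

end GridDrawing

/-!
Root the tree anywhere, let `n` be the number of vertices and `e = n - 1` the number of edges, and
let `l` be the number of terminal vertices, that is, of childless vertices other than the root.
There are two drawings. One uses at most `l` segments. The other uses `k` segments, where
`2 * k + 2 ≤ 3 * n - 2 * l`. If `l ≤ ⌈3 * e / 4⌉` the first is good enough; otherwise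
`2 * k ≤ 3 * e + 1 - 2 * l` gives `k ≤ ⌈3 * e / 4⌉` for the second. Both fit on a grid of size
`3 * n ^ 2` by `3 * n`.

Both rest on a weighted depth-first numbering (`Rooting.offset`): vertices of equal depth occupy
disjoint intervals, in an order compatible with that of their parents
(`Rooting.offset_add_le_or`, `Rooting.offset_par_of_offset_add_le`). Hence if vertices are placed on
layers given by their depth, in this order, edges do not cross (`Rooting.layered_meet`).

*First drawing.* The edge from the parent of `v` to `v` is the vector `(s, 1)`, where `s` is the
number of terminal vertices that a depth-first traversal meets before the subtree of `v`. These
slopes strictly increase along each layer, so the order is kept. A first child has the same slope as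
its parent, so the edges split into straight chains, one for each terminal vertex
(`Rooting.usesAtMostSegments_chainPos`).

*Second drawing.* The non-terminal vertices are placed on layers at distance `3 * n`, with heights
below `3 * n`, so that edges between layers have slope less than `1` in absolute value. A vertex
with `m` terminal children gets vertical room `m` above and below itself, and these children are put
at displacements `(1, 1), (-1, -1), (1, 2), (-1, -2), …`, which are too steep to meet the edges
between layers (`Rooting.leaf_inner_meet`). Each opposite pair shares a segment, so the number of
segments is at most the number of edges between layers plus the sum of the `⌈m / 2⌉`
(`Rooting.usesAtMostSegments_fanPos`).
-/

namespace GridDrawing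

/-! ### Rooted trees -/

/-- A rooting of the graph `T`: a root, a parent function and a depth function such that the edges
of `T` are exactly the pairs of a non-root vertex and its parent. The root is its own parent. -/
structure Rooting {V : Type*} (T : SimpleGraph V) where
  /-- The root. -/
  root : V
  /-- The parent of a vertex; the root is its own parent. -/
  par : V → V
  /-- The distance to the root. -/
  depth : V → ℕ
  par_root : par root = root
  depth_root : depth root = 0
  depth_par : ∀ v, v ≠ root → depth v = depth (par v) + 1
  adj_iff : ∀ u v, T.Adj u v ↔ (u ≠ root ∧ par u = v) ∨ (v ≠ root ∧ par v = u)

theorem exists_rooting {V : Type*} {T : SimpleGraph V} (hT : T.IsTree) : Nonempty (Rooting T) := by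
  classical
  obtain ⟨r⟩ := hT.connected.nonempty
  choose f hf hlen using hT.connected.exists_path_of_dist r
  have hnil : ∀ v, v ≠ r → ¬ (f v).Nil := fun v hv => SimpleGraph.Walk.not_nil_of_ne hv.symm
  have hsub := hT.isAcyclic.subsingleton_path
  have huniq : ∀ v w, T.Adj w v → T.dist r v = T.dist r w + 1 → (f v).penultimate = w := by
    intro v w h hd
    have hp : ((f w).concat h).IsPath :=
      SimpleGraph.Walk.isPath_of_length_eq_dist _ (by simp [hlen, hd])
    have := congrArg Subtype.val ((hsub r v).elim ⟨_, hp⟩ ⟨_, hf v⟩)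
    simp only at this
    rw [← this]
    simp
  have hadj : ∀ v, v ≠ r → T.Adj (f v).penultimate v := fun v hv =>
    SimpleGraph.Walk.adj_penultimate (hnil v hv)
  have hdist : ∀ v, v ≠ r → T.dist r v = T.dist r (f v).penultimate + 1 := by
    intro v hv
    rcases hT.dist_eq_dist_add_one_of_adj r (hadj v hv) with h | h
    · exfalso
      -- Deleting the last edge of a shortest path to `v` leaves a shorter path to its penultimate
      -- vertex.
      have h1 := SimpleGraph.dist_le (f v).dropLast
      have h2 : (f v).dropLast.length + 1 = (f v).length :=
        SimpleGraph.Walk.length_dropLast_add_one (hnil v hv)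
      rw [hlen v] at h2
      omega
    · exact h
  refine ⟨⟨r, fun v => if v = r then r else (f v).penultimate, T.dist r, by simp, by simp, ?_, ?_⟩⟩
  · intro v hv
    simpa [hv] using hdist v hv
  · intro u v
    constructor
    · intro h
      rcases hT.dist_eq_dist_add_one_of_adj r h with h' | h'
      · have hu : u ≠ r := by rintro rfl; simp at h'
        exact Or.inl ⟨hu, by simpa [hu] using huniq u v h.symm h'⟩
      · have hv : v ≠ r := by rintro rfl; simp at h'
        exact Or.inr ⟨hv, by simpa [hv] using huniq v u h h'⟩
    · rintro (⟨hu, h⟩ | ⟨hv, h⟩)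
      · rw [if_neg hu] at h
        exact h ▸ (hadj u hu).symm
      · rw [if_neg hv] at h
        exact h ▸ hadj v hv

namespace Rooting

variable {V : Type*} {T : SimpleGraph V} (R : Rooting T)

theorem depth_par_eq_sub (v : V) : R.depth (R.par v) = R.depth v - 1 := by
  by_cases hv : v = R.root
  · subst hv; simp [R.par_root, R.depth_root]
  · have := R.depth_par v hv; omega

theorem depth_iterate_par (k : ℕ) (v : V) : R.depth (R.par^[k] v) = R.depth v - k := by
  induction k with
  | zero => rfl
  | succ k ih => rw [Function.iterate_succ_apply', depth_par_eq_sub, ih]; omega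

theorem depth_eq_zero_iff {v : V} : R.depth v = 0 ↔ v = R.root := by
  constructor
  · intro h
    by_contra hv
    have := R.depth_par v hv
    omega
  · rintro rfl; exact R.depth_root

theorem par_ne {v : V} (hv : v ≠ R.root) : R.par v ≠ v := by
  intro h
  have := R.depth_par v hv
  rw [h] at this
  omega

theorem adj_par {v : V} (hv : v ≠ R.root) : T.Adj (R.par v) v :=
  (R.adj_iff _ _).2 (Or.inr ⟨hv, rfl⟩)

theorem exists_edge_eq {u v : V} (h : T.Adj u v) :
    ∃ c, c ≠ R.root ∧ s(u, v) = s(R.par c, c) := by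
  rcases (R.adj_iff u v).1 h with ⟨hu, rfl⟩ | ⟨hv, rfl⟩
  · exact ⟨u, hu, Sym2.eq_swap⟩
  · exact ⟨v, hv, rfl⟩

theorem ne_root_of_depth_eq {u v : V} (hd : R.depth u = R.depth v) (hne : u ≠ v) :
    u ≠ R.root := by
  rintro rfl
  rw [R.depth_root] at hd
  exact hne (R.depth_eq_zero_iff.1 hd.symm).symm

theorem depth_lt_card [Fintype V] (v : V) : R.depth v < Fintype.card V := by
  classical
  -- All numbers up to the depth of `v` are depths of ancestors of `v`.
  have hsub : Finset.range (R.depth v + 1) ⊆ Finset.univ.image R.depth := by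
    intro k hk
    simp only [Finset.mem_range] at hk
    simp only [Finset.mem_image, Finset.mem_univ, true_and]
    exact ⟨R.par^[R.depth v - k] v, by rw [depth_iterate_par]; omega⟩
  have h := (Finset.card_le_card hsub).trans Finset.card_image_le
  rw [Finset.card_range] at h
  exact h

/-- A vertex is terminal if it is not the root and has no children. -/
def IsTerminal (v : V) : Prop := v ≠ R.root ∧ ∀ c, c ≠ R.root → R.par c ≠ v

end Rooting

namespace Rooting

/-! ### Weighted depth-first numbering -/

variable {V : Type*} {T : SimpleGraph V} (R : Rooting T) [Fintype V]

open Classical in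
/-- The children of `v`. -/
noncomputable def children (v : V) : Finset V := {c | c ≠ R.root ∧ R.par c = v}

open Classical in
/-- The vertices of the subtree rooted at `v`, including `v`. -/
noncomputable def descendants (v : V) : Finset V :=
  {u | R.depth v ≤ R.depth u ∧ R.par^[R.depth u - R.depth v] u = v}

/-- The total weight of the subtree rooted at `v`. -/
noncomputable def subtreeWeight (w : V → ℕ) (v : V) : ℕ := ∑ u ∈ R.descendants v, w u

/-- The siblings of `c` that precede it in a fixed enumeration of the vertices. -/
noncomputable def elderSiblings (c : V) : Finset V :=
  {c' ∈ R.children (R.par c) | Fintype.equivFin V c' < Fintype.equivFin V c}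

/-- The recursion behind `Rooting.offset`, with the depth of the vertex as fuel. -/
noncomputable def offsetAux (w : V → ℕ) : ℕ → V → ℕ
  | 0, _ => 0
  | k + 1, c =>
    offsetAux w k (R.par c) + w (R.par c) + ∑ c' ∈ R.elderSiblings c, R.subtreeWeight w c'

/-- The total weight of the vertices preceding `v` in a depth-first traversal. -/
noncomputable def offset (w : V → ℕ) (v : V) : ℕ := R.offsetAux w (R.depth v) v

variable {R} in
theorem mem_children {c v : V} : c ∈ R.children v ↔ c ≠ R.root ∧ R.par c = v := by
  simp [children]

variable {R} in
theorem mem_descendants {u v : V} :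
    u ∈ R.descendants v ↔ R.depth v ≤ R.depth u ∧ R.par^[R.depth u - R.depth v] u = v := by
  simp [descendants]

theorem offset_root (w : V → ℕ) : R.offset w R.root = 0 := by
  simp [offset, R.depth_root, offsetAux]

theorem offset_eq (w : V → ℕ) {c : V} (hc : c ≠ R.root) :
    R.offset w c = R.offset w (R.par c) + w (R.par c) +
      ∑ c' ∈ R.elderSiblings c, R.subtreeWeight w c' := by
  rw [offset, R.depth_par c hc, offsetAux, ← offset]

theorem self_mem_descendants (v : V) : v ∈ R.descendants v := by simp [mem_descendants]

theorem subset_descendants_par {c : V} (hc : c ≠ R.root) :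
    R.descendants c ⊆ R.descendants (R.par c) := by
  intro u hu
  rw [mem_descendants] at hu ⊢
  have hd := R.depth_par c hc
  refine ⟨by omega, ?_⟩
  have : R.depth u - R.depth (R.par c) = (R.depth u - R.depth c) + 1 := by omega
  rw [this, Function.iterate_succ_apply', hu.2]

theorem disjoint_descendants {u v : V} (hd : R.depth u = R.depth v) (hne : u ≠ v) :
    Disjoint (R.descendants u) (R.descendants v) := by
  rw [Finset.disjoint_left]
  intro x hx hx'
  rw [mem_descendants] at hx hx'
  exact hne (by rw [← hx.2, ← hx'.2, hd])

theorem le_subtreeWeight (w : V → ℕ) (v : V) : w v ≤ R.subtreeWeight w v :=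
  Finset.single_le_sum (f := w) (fun _ _ => Nat.zero_le _) (R.self_mem_descendants v)

theorem subtreeWeight_le (w : V → ℕ) (v : V) : R.subtreeWeight w v ≤ ∑ u, w u :=
  Finset.sum_le_sum_of_subset (Finset.subset_univ _)

theorem depth_eq_of_mem_children {c v : V} (hc : c ∈ R.children v) :
    R.depth c = R.depth v + 1 := by
  rw [mem_children] at hc
  rw [R.depth_par c hc.1, hc.2]

theorem add_sum_children_le (w : V → ℕ) (v : V) :
    w v + ∑ c ∈ R.children v, R.subtreeWeight w c ≤ R.subtreeWeight w v := by
  classical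
  have hdisj : Set.PairwiseDisjoint (↑(R.children v)) R.descendants := by
    intro a ha b hb hab
    exact R.disjoint_descendants
      ((R.depth_eq_of_mem_children ha).trans (R.depth_eq_of_mem_children hb).symm) hab
  have hv : v ∉ (R.children v).biUnion R.descendants := by
    simp only [Finset.mem_biUnion, not_exists, not_and]
    intro c hc hvc
    have := R.depth_eq_of_mem_children hc
    have := (mem_descendants.1 hvc).1
    omega
  unfold subtreeWeight
  rw [← Finset.sum_biUnion hdisj, ← Finset.sum_insert hv]
  refine Finset.sum_le_sum_of_subset (Finset.insert_subset (R.self_mem_descendants v) ?_)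
  rw [Finset.biUnion_subset]
  intro c hc
  rw [mem_children] at hc
  exact hc.2 ▸ R.subset_descendants_par hc.1

variable {R} in
theorem mem_elderSiblings {c c' : V} : c' ∈ R.elderSiblings c ↔
    (c' ≠ R.root ∧ R.par c' = R.par c) ∧ Fintype.equivFin V c' < Fintype.equivFin V c := by
  simp [elderSiblings, mem_children]

theorem sum_elderSiblings_add_le (w : V → ℕ) {c : V} {S : Finset V}
    (hS : R.elderSiblings c ⊆ S) (hc : c ∈ S) :
    ∑ c' ∈ R.elderSiblings c, R.subtreeWeight w c' + R.subtreeWeight w c ≤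
      ∑ c' ∈ S, R.subtreeWeight w c' := by
  classical
  have h : c ∉ R.elderSiblings c := by simp [mem_elderSiblings]
  rw [add_comm, ← Finset.sum_insert h]
  exact Finset.sum_le_sum_of_subset (Finset.insert_subset hc hS)

theorem offset_par_add_le (w : V → ℕ) {c : V} (hc : c ≠ R.root) :
    R.offset w (R.par c) + w (R.par c) ≤ R.offset w c := by
  rw [R.offset_eq w hc]; omega

theorem offset_add_le_par (w : V → ℕ) {c : V} (hc : c ≠ R.root) :
    R.offset w c + R.subtreeWeight w c ≤
      R.offset w (R.par c) + R.subtreeWeight w (R.par c) := by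
  have h1 := R.sum_elderSiblings_add_le w (c := c) (S := R.children (R.par c))
    (Finset.filter_subset _ _) (mem_children.2 ⟨hc, rfl⟩)
  have h2 := R.add_sum_children_le w (R.par c)
  rw [R.offset_eq w hc]
  omega

theorem offset_add_le_of_siblings (w : V → ℕ) {u v : V} (hu : u ≠ R.root) (hv : v ≠ R.root)
    (hp : R.par u = R.par v) (hlt : Fintype.equivFin V u < Fintype.equivFin V v) :
    R.offset w u + R.subtreeWeight w u ≤ R.offset w v := by
  have h1 := R.sum_elderSiblings_add_le w (c := u) (S := R.elderSiblings v) (by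
    intro x hx
    rw [mem_elderSiblings] at hx ⊢
    exact ⟨⟨hx.1.1, hx.1.2.trans hp⟩, hx.2.trans hlt⟩) (mem_elderSiblings.2 ⟨⟨hu, hp⟩, hlt⟩)
  rw [R.offset_eq w hu, R.offset_eq w hv, hp]
  omega

/-- Vertices of equal depth occupy disjoint intervals of the numbering. -/
theorem offset_add_le_or (w : V → ℕ) {u v : V} (hd : R.depth u = R.depth v) (hne : u ≠ v) :
    R.offset w u + R.subtreeWeight w u ≤ R.offset w v ∨
      R.offset w v + R.subtreeWeight w v ≤ R.offset w u := by
  induction hk : R.depth u generalizing u v with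
  | zero =>
    exact absurd ((R.depth_eq_zero_iff.1 hk).trans (R.depth_eq_zero_iff.1 (hd ▸ hk)).symm) hne
  | succ k ih =>
    have hu : u ≠ R.root := fun h => by rw [h, R.depth_root] at hk; omega
    have hv : v ≠ R.root := fun h => by rw [h, R.depth_root] at hd; omega
    by_cases hp : R.par u = R.par v
    · rcases lt_trichotomy (Fintype.equivFin V u) (Fintype.equivFin V v) with h | h | h
      · exact Or.inl (R.offset_add_le_of_siblings w hu hv hp h)
      · exact absurd ((Fintype.equivFin V).injective h) hne
      · exact Or.inr (R.offset_add_le_of_siblings w hv hu hp.symm h)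
    · have hdu := R.depth_par u hu
      have hdv := R.depth_par v hv
      have h1 := R.offset_par_add_le w hu
      have h2 := R.offset_par_add_le w hv
      have h3 := R.offset_add_le_par w hu
      have h4 := R.offset_add_le_par w hv
      rcases ih (by omega) hp (by omega) with h | h
      · left; omega
      · right; omega

theorem offset_par_of_offset_add_le {w : V → ℕ} (hw : ∀ v, v ≠ R.root → 0 < R.subtreeWeight w v)
    {u v : V} (hu : u ≠ R.root) (hv : v ≠ R.root) (hd : R.depth u = R.depth v)
    (h : R.offset w u + R.subtreeWeight w u ≤ R.offset w v) :
    R.par u = R.par v ∨ R.offset w (R.par u) + R.subtreeWeight w (R.par u) ≤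
      R.offset w (R.par v) := by
  by_cases hp : R.par u = R.par v
  · exact Or.inl hp
  right
  have hdu := R.depth_par u hu
  have hdv := R.depth_par v hv
  rcases R.offset_add_le_or w (by omega : R.depth (R.par u) = R.depth (R.par v)) hp with h' | h'
  · exact h'
  · have h1 := R.offset_par_add_le w hu
    have h3 := R.offset_add_le_par w hv
    have := hw u hu
    omega

theorem offset_add_le (w : V → ℕ) (v : V) :
    R.offset w v + R.subtreeWeight w v ≤ ∑ u, w u := by
  induction hk : R.depth v generalizing v with
  | zero =>
    rw [R.depth_eq_zero_iff.1 hk, R.offset_root, zero_add]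
    exact R.subtreeWeight_le w _
  | succ k ih =>
    have hv : v ≠ R.root := fun h => by rw [h, R.depth_root] at hk; omega
    have := R.depth_par v hv
    exact (R.offset_add_le_par w hv).trans (ih _ (by omega))

theorem exists_child_offset_eq (w : V → ℕ) {v : V} (hv : (R.children v).Nonempty) :
    ∃ c ∈ R.children v, R.offset w c = R.offset w v + w v := by
  obtain ⟨c, hc, hmin⟩ := (R.children v).exists_min_image (Fintype.equivFin V) hv
  refine ⟨c, hc, ?_⟩
  have hc' := mem_children.1 hc
  have he : R.elderSiblings c = ∅ := by
    rw [Finset.eq_empty_iff_forall_notMem]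
    intro x hx
    rw [mem_elderSiblings] at hx
    have := hmin x (mem_children.2 ⟨hx.1.1, hx.1.2.trans hc'.2⟩)
    exact absurd hx.2 (not_lt.2 this)
  rw [R.offset_eq w hc'.1, he, Finset.sum_empty, hc'.2, add_zero]

theorem children_nonempty_of_not_isTerminal {v : V} (hv : v ≠ R.root) (h : ¬ R.IsTerminal v) :
    (R.children v).Nonempty := by
  simp only [IsTerminal, not_and, not_forall, not_not] at h
  obtain ⟨c, hc, hcv⟩ := h hv
  exact ⟨c, mem_children.2 ⟨hc, hcv⟩⟩

theorem exists_isTerminal_mem_descendants {v : V} (hv : v ≠ R.root) :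
    ∃ u ∈ R.descendants v, R.IsTerminal u := by
  obtain ⟨u, hu, hmax⟩ := (R.descendants v).exists_max_image R.depth ⟨v, R.self_mem_descendants v⟩
  refine ⟨u, hu, ?_⟩
  rw [mem_descendants] at hu
  have hur : u ≠ R.root := by
    rintro rfl
    have := hu.1
    rw [R.depth_root] at this
    exact hv (R.depth_eq_zero_iff.1 (by omega))
  refine ⟨hur, fun c hc hcu => ?_⟩
  have hd := R.depth_par c hc
  rw [hcu] at hd
  have := hmax c (mem_descendants.2 ⟨by omega, by
    rw [show R.depth c - R.depth v = (R.depth u - R.depth v) + 1 by omega,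
      Function.iterate_succ_apply, hcu, hu.2]⟩)
  omega

end Rooting

/-! ### Segments and layered drawings -/

theorem mem_segment_toPlane_iff {a b : ℤ × ℤ} {q : ℝ × ℝ} :
    q ∈ segment ℝ (toPlane a) (toPlane b) ↔ ∃ t : ℝ, 0 ≤ t ∧ t ≤ 1 ∧
      q.1 = a.1 + t * (b.1 - a.1) ∧ q.2 = a.2 + t * (b.2 - a.2) := by
  rw [segment_eq_image']
  simp only [Set.mem_image, Set.mem_Icc, toPlane]
  constructor
  · rintro ⟨t, ⟨h0, h1⟩, rfl⟩
    exact ⟨t, h0, h1, by simp, by simp⟩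
  · rintro ⟨t, h0, h1, h2, h3⟩
    exact ⟨t, ⟨h0, h1⟩, by ext <;> simp [h2, h3]⟩

theorem edgeSegment_symm {V : Type*} (p : V → ℤ × ℤ) (u v : V) :
    edgeSegment p u v = edgeSegment p v u := segment_symm _ _ _

/-- For a rooted tree it suffices to check injectivity and that distinct edges, each given by its
endpoint farther from the root, meet only in common endpoints. -/
theorem Rooting.isCrossingFree {V : Type*} {T : SimpleGraph V} (R : Rooting T) {p : V → ℤ × ℤ}
    (hinj : Function.Injective p)
    (h : ∀ c d, c ≠ R.root → d ≠ R.root → c ≠ d → ∀ q, q ∈ edgeSegment p (R.par c) c →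
      q ∈ edgeSegment p (R.par d) d →
      ∃ w, w ∈ s(R.par c, c) ∧ w ∈ s(R.par d, d) ∧ q = toPlane (p w)) :
    IsCrossingFree T p := by
  have hplane : ∀ u v, toPlane (p u) = toPlane (p v) → u = v := by
    intro u v huv
    simp only [toPlane, Prod.mk.injEq, Int.cast_inj] at huv
    exact hinj (Prod.ext huv.1 huv.2)
  have hseg : ∀ {u v c d}, s(u, v) = s(c, d) → edgeSegment p u v = edgeSegment p c d := by
    intro u v c d he
    rcases Sym2.eq_iff.1 he with ⟨rfl, rfl⟩ | ⟨rfl, rfl⟩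
    · rfl
    · exact edgeSegment_symm _ _ _
  have hmeet : ∀ u v x y, T.Adj u v → T.Adj x y → s(u, v) ≠ s(x, y) →
      ∀ q, q ∈ edgeSegment p u v → q ∈ edgeSegment p x y →
        ∃ w, w ∈ s(u, v) ∧ w ∈ s(x, y) ∧ q = toPlane (p w) := by
    intro u v x y huv hxy hne q hq hq'
    obtain ⟨c, hc, hce⟩ := R.exists_edge_eq huv
    obtain ⟨d, hd, hde⟩ := R.exists_edge_eq hxy
    rw [hce, hde] at hne ⊢
    rw [hseg hce] at hq
    rw [hseg hde] at hq'
    exact h c d hc hd (by rintro rfl; exact hne rfl) q hq hq'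
  refine ⟨hinj, ?_, hmeet⟩
  intro u v w huv hw
  -- Every vertex `w` is the endpoint of an edge, and that edge meets `uv` in a vertex only.
  obtain ⟨x, hx⟩ : ∃ x, T.Adj w x := by
    by_cases hwr : w = R.root
    · obtain ⟨c, hc, -⟩ := R.exists_edge_eq huv
      obtain ⟨k, hk⟩ : ∃ k, R.depth c = k + 1 :=
        Nat.exists_eq_succ_of_ne_zero (fun h => hc (R.depth_eq_zero_iff.1 h))
      have h1 : R.depth (R.par^[k] c) = 1 := by rw [R.depth_iterate_par]; omega
      have h2 : R.par^[k] c ≠ R.root := fun h => by rw [h, R.depth_root] at h1; omega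
      have h3 := R.depth_par _ h2
      have h4 : R.par (R.par^[k] c) = R.root := R.depth_eq_zero_iff.1 (by omega)
      exact ⟨_, hwr ▸ h4 ▸ R.adj_par h2⟩
    · exact ⟨_, (R.adj_par hwr).symm⟩
  by_cases he : s(u, v) = s(w, x)
  · have : w ∈ s(u, v) := he ▸ Sym2.mem_mk_left w x
    exact Sym2.mem_iff.1 this
  · obtain ⟨z, hz, -, hwz⟩ := hmeet u v w x huv hx he _ hw (left_mem_segment _ _ _)
    rw [hplane _ _ hwz]
    exact Sym2.mem_iff.1 hz

/-- Place each vertex `v` at `(A * depth v, y v)`. If the order of the vertices on each layer is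
compatible with the order of their parents, two distinct edges meet only in common endpoints. The
points on the edges from the parents to `c` and `d` are given by the parameters `t` and `t'`. -/
theorem Rooting.layered_meet {V : Type*} {T : SimpleGraph V} (R : Rooting T) {y : V → ℤ} {A : ℝ}
    (hA : 0 < A)
    (hinj : ∀ u v, R.depth u = R.depth v → y u = y v → u = v)
    (hmono : ∀ u v, u ≠ R.root → v ≠ R.root → R.depth u = R.depth v → y u < y v →
      y (R.par u) ≤ y (R.par v))
    {c d : V} (hc : c ≠ R.root) (hd : d ≠ R.root) (hcd : c ≠ d) {t t' : ℝ}
    (ht0 : 0 ≤ t) (ht1 : t ≤ 1) (ht0' : 0 ≤ t') (ht1' : t' ≤ 1)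
    (hx : A * R.depth (R.par c) + t * A = A * R.depth (R.par d) + t' * A)
    (hy : (y (R.par c) : ℝ) + t * (y c - y (R.par c)) =
      y (R.par d) + t' * (y d - y (R.par d))) :
    (t = 0 ∧ t' = 0 ∧ R.par c = R.par d) ∨ (t = 1 ∧ t' = 0 ∧ c = R.par d) ∨
      (t = 0 ∧ t' = 1 ∧ R.par c = d) := by
  have hx' : (R.depth (R.par c) : ℝ) + t = R.depth (R.par d) + t' := by
    have : A * (R.depth (R.par c) + t) = A * (R.depth (R.par d) + t') := by linarith
    exact mul_left_cancel₀ hA.ne' this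
  have hdc := R.depth_par c hc
  have hdd := R.depth_par d hd
  rcases lt_trichotomy (R.depth (R.par c)) (R.depth (R.par d)) with hlt | heq | hlt
  · have h1 : (R.depth (R.par c) : ℝ) + 1 ≤ R.depth (R.par d) := by exact_mod_cast hlt
    obtain rfl : t = 1 := by linarith
    obtain rfl : t' = 0 := by linarith
    have h2 : R.depth (R.par d) = R.depth c := by
      rw [hdc]
      have : (R.depth (R.par d) : ℝ) = R.depth (R.par c) + 1 := by linarith
      exact_mod_cast this
    refine Or.inr (Or.inl ⟨rfl, rfl, hinj _ _ h2.symm ?_⟩)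
    have : (y c : ℝ) = y (R.par d) := by linarith
    exact_mod_cast this
  · rw [heq] at hx'
    obtain rfl : t = t' := by linarith
    left
    -- Two affine functions, weakly ordered at `0` and strictly ordered at `1`, agree at most at `0`.
    have key : ∀ a b a' b' : ℝ, a ≤ a' → b < b' → a + t * (b - a) = a' + t * (b' - a') →
        t = 0 ∧ a = a' := by
      intro a b a' b' h1 h2 h3
      have h4 : (1 - t) * (a' - a) + t * (b' - b) = 0 := by linarith
      have h5 : 0 ≤ (1 - t) * (a' - a) := mul_nonneg (by linarith) (by linarith)
      have h6 : 0 ≤ t * (b' - b) := mul_nonneg ht0 (by linarith)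
      have h7 : t * (b' - b) = 0 := by linarith
      rcases mul_eq_zero.1 h7 with h8 | h8
      · refine ⟨h8, ?_⟩
        rw [h8] at h3
        linarith
      · linarith
    have hde : R.depth c = R.depth d := by omega
    rcases lt_trichotomy (y c) (y d) with h | h | h
    · obtain ⟨h0, h1⟩ := key _ _ _ _ (Int.cast_le.2 (hmono c d hc hd hde h)) (Int.cast_lt.2 h) hy
      exact ⟨h0, h0, hinj _ _ heq (by exact_mod_cast h1)⟩
    · exact absurd (hinj _ _ hde h) hcd
    · obtain ⟨h0, h1⟩ :=
        key _ _ _ _ (Int.cast_le.2 (hmono d c hd hc hde.symm h)) (Int.cast_lt.2 h) hy.symm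
      exact ⟨h0, h0, hinj _ _ heq (by exact_mod_cast h1.symm)⟩
  · have h1 : (R.depth (R.par d) : ℝ) + 1 ≤ R.depth (R.par c) := by exact_mod_cast hlt
    obtain rfl : t' = 1 := by linarith
    obtain rfl : t = 0 := by linarith
    have h2 : R.depth (R.par c) = R.depth d := by
      rw [hdd]
      have : (R.depth (R.par c) : ℝ) = R.depth (R.par d) + 1 := by linarith
      exact_mod_cast this
    refine Or.inr (Or.inr ⟨rfl, rfl, hinj _ _ h2 ?_⟩)
    have : (y (R.par c) : ℝ) = y d := by linarith
    exact_mod_cast this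

namespace Rooting

variable {V : Type*} {T : SimpleGraph V} (R : Rooting T) [Fintype V]

/-! ### Drawing every chain of first children straight -/

open Classical in
/-- The terminal vertices. -/
noncomputable def terminals : Finset V := {v | R.IsTerminal v}

open Classical in
/-- The weight counting terminal vertices. -/
noncomputable def terminalWeight (v : V) : ℕ := if R.IsTerminal v then 1 else 0

/-- The slope of the edge from the parent of `v` to `v`: the number of terminal vertices that come
before the subtree of `v` in a depth-first traversal. A first child has the same slope as its
parent. -/
noncomputable def slope (v : V) : ℕ := R.offset R.terminalWeight v

/-- The recursion behind `Rooting.shift`, with the depth of the vertex as fuel. -/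
noncomputable def shiftAux : ℕ → V → ℕ
  | 0, _ => 0
  | k + 1, c => shiftAux k (R.par c) + R.slope c

/-- The sum of the slopes on the path from the root to `v`. -/
noncomputable def shift (v : V) : ℕ := R.shiftAux (R.depth v) v

theorem shift_root : R.shift R.root = 0 := by simp [shift, R.depth_root, shiftAux]

theorem shift_eq {c : V} (hc : c ≠ R.root) : R.shift c = R.shift (R.par c) + R.slope c := by
  rw [shift, R.depth_par c hc, shiftAux, ← shift]

theorem subtreeWeight_terminalWeight_pos {v : V} (hv : v ≠ R.root) :
    0 < R.subtreeWeight R.terminalWeight v := by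
  obtain ⟨u, hu, ht⟩ := R.exists_isTerminal_mem_descendants hv
  have h := Finset.single_le_sum (f := R.terminalWeight) (fun _ _ => Nat.zero_le _) hu
  have h1 : R.terminalWeight u = 1 := if_pos ht
  rw [h1] at h
  exact h

theorem shift_lt_of_offset_add_le {u v : V} (hu : u ≠ R.root) (hd : R.depth u = R.depth v)
    (h : R.slope u + R.subtreeWeight R.terminalWeight u ≤ R.slope v) :
    R.shift u < R.shift v := by
  induction hk : R.depth u generalizing u v with
  | zero => exact absurd (R.depth_eq_zero_iff.1 hk) hu
  | succ k ih =>
    have hv : v ≠ R.root := fun h => by rw [h, R.depth_root] at hd; omega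
    have hpos := R.subtreeWeight_terminalWeight_pos hu
    have hdu := R.depth_par u hu
    have hdv := R.depth_par v hv
    rw [R.shift_eq hu, R.shift_eq hv]
    rcases R.offset_par_of_offset_add_le (fun v => R.subtreeWeight_terminalWeight_pos) hu hv hd h
      with hp | hp
    · rw [hp]; omega
    · by_cases hr : R.par u = R.root
      · have hr' : R.par v = R.root := by
          rw [← R.depth_eq_zero_iff] at hr ⊢
          omega
        rw [hr, hr']; omega
      · have := ih hr (by omega) hp (by omega)
        omega

theorem shift_injective_of_depth_eq {u v : V} (hd : R.depth u = R.depth v)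
    (h : R.shift u = R.shift v) : u = v := by
  by_contra hne
  rcases R.offset_add_le_or R.terminalWeight hd hne with h' | h'
  · exact (R.shift_lt_of_offset_add_le (R.ne_root_of_depth_eq hd hne) hd h').ne h
  · exact (R.shift_lt_of_offset_add_le (R.ne_root_of_depth_eq hd.symm (Ne.symm hne)) hd.symm h').ne'
      h

theorem shift_par_le {u v : V} (hu : u ≠ R.root) (hv : v ≠ R.root) (hd : R.depth u = R.depth v)
    (h : R.shift u < R.shift v) : R.shift (R.par u) ≤ R.shift (R.par v) := by
  have hne : u ≠ v := by rintro rfl; exact lt_irrefl _ h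
  rcases R.offset_add_le_or R.terminalWeight hd hne with h' | h'
  · rcases R.offset_par_of_offset_add_le (fun v => R.subtreeWeight_terminalWeight_pos) hu hv hd h'
      with hp | hp
    · rw [hp]
    · have hdp : R.depth (R.par u) = R.depth (R.par v) := by
        rw [R.depth_par_eq_sub, R.depth_par_eq_sub, hd]
      by_cases hpp : R.par u = R.par v
      · rw [hpp]
      · exact (R.shift_lt_of_offset_add_le (R.ne_root_of_depth_eq hdp hpp) hdp hp).le
  · exact absurd (R.shift_lt_of_offset_add_le hv hd.symm h') h.not_gt

theorem slope_le (v : V) : R.slope v ≤ Fintype.card V := by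
  have h := R.offset_add_le R.terminalWeight v
  have h2 : ∑ u, R.terminalWeight u ≤ ∑ _u : V, 1 := by
    refine Finset.sum_le_sum fun u _ => ?_
    unfold terminalWeight
    split_ifs <;> simp
  simp only [Finset.sum_const, Finset.card_univ, smul_eq_mul, mul_one] at h2
  exact (Nat.le_add_right _ _).trans (h.trans h2)

theorem shift_le (v : V) : R.shift v ≤ R.depth v * Fintype.card V := by
  induction hk : R.depth v generalizing v with
  | zero => rw [R.depth_eq_zero_iff.1 hk, R.shift_root]; simp
  | succ k ih =>
    have hv : v ≠ R.root := fun h => by rw [h, R.depth_root] at hk; omega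
    have := R.depth_par v hv
    have h1 := ih (R.par v) (by omega)
    have h2 := R.slope_le v
    rw [R.shift_eq hv, add_mul, one_mul]
    omega

/-- Each vertex is placed on the row given by its depth, and the edge from its parent is the
vector `(slope v, 1)`. -/
noncomputable def chainPos (v : V) : ℤ × ℤ := ((R.shift v : ℤ), (R.depth v : ℤ))

theorem isCrossingFree_chainPos : IsCrossingFree T R.chainPos := by
  refine R.isCrossingFree ?_ ?_
  · intro u v h
    simp only [chainPos, Prod.mk.injEq, Nat.cast_inj] at h
    exact R.shift_injective_of_depth_eq h.2 h.1
  · intro c d hc hd hcd q hq hq'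
    obtain ⟨t, ht0, ht1, hx, hy⟩ := mem_segment_toPlane_iff.1 hq
    obtain ⟨t', ht0', ht1', hx', hy'⟩ := mem_segment_toPlane_iff.1 hq'
    have hdc : (R.depth c : ℝ) = R.depth (R.par c) + 1 := by exact_mod_cast R.depth_par c hc
    have hdd : (R.depth d : ℝ) = R.depth (R.par d) + 1 := by exact_mod_cast R.depth_par d hd
    simp only [chainPos, Int.cast_natCast] at hx hy hx' hy'
    have hends : ∀ v, q.1 = R.shift v → q.2 = R.depth v → q = toPlane (R.chainPos v) := by
      intro v h1 h2
      ext <;> simp [toPlane, chainPos, h1, h2]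
    rcases R.layered_meet (y := fun v => (R.shift v : ℤ)) one_pos
      (fun u v h h' => R.shift_injective_of_depth_eq h (by exact_mod_cast h'))
      (fun u v hu hv h h' => by exact_mod_cast R.shift_par_le hu hv h (by exact_mod_cast h'))
      hc hd hcd ht0 ht1 ht0' ht1' (by rw [hdc] at hy; rw [hdd] at hy'; linarith)
      (by push_cast; linarith) with ⟨h, -, hp⟩ | ⟨h, -, hp⟩ | ⟨h, -, hp⟩
    · exact ⟨R.par c, by simp, by simp [hp], hends _ (by rw [hx, h]; ring) (by rw [hy, h]; ring)⟩
    · exact ⟨c, by simp, by simp [hp], hends _ (by rw [hx, h]; ring) (by rw [hy, h]; ring)⟩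
    · exact ⟨R.par c, by simp, by simp [hp], hends _ (by rw [hx, h]; ring) (by rw [hy, h]; ring)⟩

/-- The first `k` edges on the path from `u` to the root exist and have the slope of `u`. -/
def IsStraight (u : V) (k : ℕ) : Prop :=
  ∀ j < k, R.par^[j] u ≠ R.root ∧ R.slope (R.par^[j] u) = R.slope u

variable {R} in
theorem IsStraight.mono {u : V} {j k : ℕ} (h : R.IsStraight u k) (hjk : j ≤ k) :
    R.IsStraight u j := fun i hi => h i (hi.trans_le hjk)

variable {R} in
theorem IsStraight.shift_eq {u : V} {k : ℕ} (h : R.IsStraight u k) :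
    R.shift u = R.shift (R.par^[k] u) + k * R.slope u := by
  induction k with
  | zero => simp
  | succ k ih =>
    have h1 := ih (h.mono (Nat.le_succ k))
    have h2 := h k (Nat.lt_succ_self k)
    rw [h1, R.shift_eq h2.1, h2.2, Function.iterate_succ_apply']
    ring

variable {R} in
theorem IsStraight.depth_eq {u : V} {k : ℕ} (h : R.IsStraight u k) :
    R.depth u = R.depth (R.par^[k] u) + k := by
  induction k with
  | zero => simp
  | succ k ih =>
    have h1 := ih (h.mono (Nat.le_succ k))
    have h2 := h k (Nat.lt_succ_self k)
    rw [h1, R.depth_par _ h2.1, Function.iterate_succ_apply']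
    ring

variable {R} in
theorem IsStraight.mem_segment_iff {u : V} {k : ℕ} (h : R.IsStraight u k) {q : ℝ × ℝ} :
    q ∈ segment ℝ (toPlane (R.chainPos (R.par^[k] u))) (toPlane (R.chainPos u)) ↔
      ∃ t : ℝ, 0 ≤ t ∧ t ≤ 1 ∧ q.1 = R.shift u - (1 - t) * k * R.slope u ∧
        q.2 = R.depth u - (1 - t) * k := by
  rw [mem_segment_toPlane_iff]
  have h1 : (R.shift u : ℝ) = R.shift (R.par^[k] u) + k * R.slope u := by exact_mod_cast h.shift_eq
  have h2 : (R.depth u : ℝ) = R.depth (R.par^[k] u) + k := by exact_mod_cast h.depth_eq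
  simp only [chainPos, Int.cast_natCast, h1, h2]
  refine exists_congr fun t => and_congr_right fun _ => and_congr_right fun _ => ?_
  ring_nf

variable {R} in
theorem IsStraight.segment_subset {u : V} {k : ℕ} (h : R.IsStraight u k) (hk : 0 < k) :
    segment ℝ (toPlane (R.chainPos (R.par^[k] u))) (toPlane (R.chainPos u)) ⊆
      drawnEdges T R.chainPos := by
  induction k with
  | zero => exact absurd hk (lt_irrefl _)
  | succ k ih =>
    intro q hq
    obtain ⟨t, ht0, ht1, hx, hy⟩ := h.mem_segment_iff.1 hq
    have h' := h.mono (Nat.le_succ k)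
    have hlast := h k (Nat.lt_succ_self k)
    push_cast at hx hy
    by_cases hsmall : t * (k + 1) ≤ 1
    · -- The point lies on the topmost edge of the chain.
      refine ⟨R.par (R.par^[k] u), R.par^[k] u, R.adj_par hlast.1, ?_⟩
      rw [edgeSegment, mem_segment_toPlane_iff]
      have h1 : (R.shift u : ℝ) = R.shift (R.par^[k] u) + k * R.slope u := by
        exact_mod_cast h'.shift_eq
      have h2 : (R.depth u : ℝ) = R.depth (R.par^[k] u) + k := by exact_mod_cast h'.depth_eq
      have h3 : (R.shift (R.par^[k] u) : ℝ) = R.shift (R.par (R.par^[k] u)) + R.slope u := by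
        have := R.shift_eq hlast.1
        rw [hlast.2] at this
        exact_mod_cast this
      have h4 : (R.depth (R.par^[k] u) : ℝ) = R.depth (R.par (R.par^[k] u)) + 1 := by
        exact_mod_cast R.depth_par _ hlast.1
      refine ⟨t * (k + 1), by positivity, hsmall, ?_, ?_⟩
      · simp only [chainPos, Int.cast_natCast]
        rw [hx, h1, h3]; ring
      · simp only [chainPos, Int.cast_natCast]
        rw [hy, h2, h4]; ring
    · have hk0 : 0 < k := by
        rcases Nat.eq_zero_or_pos k with rfl | h0
        · exact absurd (by simpa using ht1) hsmall
        · exact h0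
      have hk0' : (0 : ℝ) < k := by exact_mod_cast hk0
      refine ih h' hk0 (h'.mem_segment_iff.2 ⟨(t * (k + 1) - 1) / k, ?_, ?_, ?_, ?_⟩)
      · exact div_nonneg (by linarith) hk0'.le
      · rw [div_le_one hk0']
        nlinarith
      · rw [hx]; field_simp; ring
      · rw [hy]; field_simp; ring

variable {R} in
theorem IsStraight.iterate_mem_segment {u : V} {k j : ℕ} (h : R.IsStraight u k) (hjk : j ≤ k) :
    toPlane (R.chainPos (R.par^[j] u)) ∈
      segment ℝ (toPlane (R.chainPos (R.par^[k] u))) (toPlane (R.chainPos u)) := by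
  rcases Nat.eq_zero_or_pos k with rfl | hk
  · obtain rfl : j = 0 := by omega
    exact right_mem_segment _ _ _
  have hk' : (0 : ℝ) < k := by exact_mod_cast hk
  have hjk' : (j : ℝ) ≤ k := by exact_mod_cast hjk
  have h' := h.mono hjk
  have h1 : (R.shift u : ℝ) = R.shift (R.par^[j] u) + j * R.slope u := by
    exact_mod_cast h'.shift_eq
  have h2 : (R.depth u : ℝ) = R.depth (R.par^[j] u) + j := by exact_mod_cast h'.depth_eq
  refine h.mem_segment_iff.2 ⟨1 - j / k, ?_, ?_, ?_, ?_⟩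
  · rw [sub_nonneg, div_le_one hk']; exact hjk'
  · linarith [div_nonneg (Nat.cast_nonneg (α := ℝ) j) hk'.le]
  · simp only [toPlane, chainPos, Int.cast_natCast]
    rw [h1]; field_simp; ring
  · simp only [toPlane, chainPos, Int.cast_natCast]
    rw [h2]; field_simp; ring

/-- Every edge lies on a straight chain ending in a terminal vertex. -/
theorem exists_isStraight {c : V} (hc : c ≠ R.root) :
    ∃ u ∈ R.terminals, ∃ j, R.par^[j] u = c ∧ R.IsStraight u (j + 1) := by
  -- Induction from the deepest layer upwards, passing to a first child.
  induction hm : Fintype.card V - R.depth c generalizing c with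
  | zero =>
    have := R.depth_lt_card c
    omega
  | succ m ih =>
    by_cases hcT : R.IsTerminal c
    · refine ⟨c, by simpa [terminals] using hcT, 0, rfl, ?_⟩
      intro j hj
      obtain rfl : j = 0 := by omega
      exact ⟨hc, rfl⟩
    · obtain ⟨d, hd, hs⟩ := R.exists_child_offset_eq R.terminalWeight
        (R.children_nonempty_of_not_isTerminal hc hcT)
      have hdd := R.depth_eq_of_mem_children hd
      rw [mem_children] at hd
      have hw : R.terminalWeight c = 0 := if_neg hcT
      rw [hw, add_zero] at hs
      obtain ⟨u, hu, j, hj, hst⟩ := ih hd.1 (by omega)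
      have hju : R.par^[j + 1] u = c := by rw [Function.iterate_succ_apply', hj, hd.2]
      refine ⟨u, hu, j + 1, hju, ?_⟩
      intro i hi
      rcases Nat.lt_succ_iff_lt_or_eq.1 hi with hi | rfl
      · exact hst i hi
      · rw [hju]
        refine ⟨hc, ?_⟩
        have := (hst j (Nat.lt_succ_self j)).2
        rw [hj] at this
        exact hs.symm.trans this

open Classical in
/-- The length of the maximal straight chain ending in `u`. -/
noncomputable def chainLength (u : V) : ℕ := Nat.findGreatest (R.IsStraight u) (R.depth u)

theorem isStraight_chainLength (u : V) : R.IsStraight u (R.chainLength u) := by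
  classical
  exact Nat.findGreatest_spec (P := R.IsStraight u) (Nat.zero_le (R.depth u))
    (fun _ hj => absurd hj (Nat.not_lt_zero _))

variable {R} in
theorem IsStraight.le_chainLength {u : V} {k : ℕ} (h : R.IsStraight u k) :
    k ≤ R.chainLength u := by
  classical
  exact Nat.le_findGreatest (by rw [h.depth_eq]; omega) h

theorem usesAtMostSegments_chainPos :
    UsesAtMostSegments T R.chainPos R.terminals.card := by
  classical
  refine ⟨R.terminals.image fun u =>
    segment ℝ (toPlane (R.chainPos (R.par^[R.chainLength u] u))) (toPlane (R.chainPos u)),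
    Finset.card_image_le, ?_, ?_⟩
  · intro s hs
    obtain ⟨u, hu, rfl⟩ := Finset.mem_image.1 hs
    have hu' : R.IsTerminal u := by simpa [terminals] using hu
    have hst := R.isStraight_chainLength u
    have hpos : 1 ≤ R.chainLength u := by
      refine IsStraight.le_chainLength fun j hj => ?_
      obtain rfl : j = 0 := by omega
      exact ⟨hu'.1, rfl⟩
    refine ⟨hst.segment_subset hpos, _, _, ?_, rfl⟩
    intro h
    have h2 := congrArg Prod.snd h
    simp only [toPlane, chainPos, Int.cast_natCast, Nat.cast_inj] at h2
    have := hst.depth_eq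
    omega
  · intro x y hxy
    obtain ⟨c, hc, he⟩ := R.exists_edge_eq hxy
    obtain ⟨u, hu, j, rfl, hst⟩ := R.exists_isStraight hc
    refine ⟨_, Finset.mem_image_of_mem _ hu, ?_⟩
    have hle := hst.le_chainLength
    have h1 := (R.isStraight_chainLength u).iterate_mem_segment (j := j) (by omega)
    have h2 := (R.isStraight_chainLength u).iterate_mem_segment (j := j + 1) hle
    rw [Function.iterate_succ_apply'] at h2
    rcases Sym2.eq_iff.1 he with ⟨rfl, rfl⟩ | ⟨rfl, rfl⟩
    · exact (convex_segment _ _).segment_subset h2 h1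
    · exact (convex_segment _ _).segment_subset h1 h2

theorem onGrid_chainPos :
    OnGrid R.chainPos (3 * Fintype.card V ^ 2) (3 * Fintype.card V) := by
  intro v
  have h1 := R.depth_lt_card v
  have h2 := R.shift_le v
  have h3 : R.shift v < 3 * Fintype.card V ^ 2 := by nlinarith
  simp only [chainPos]
  refine ⟨by positivity, by exact_mod_cast h3, by positivity, ?_⟩
  have : R.depth v < 3 * Fintype.card V := by omega
  exact_mod_cast this

end Rooting

namespace Rooting

variable {V : Type*} {T : SimpleGraph V} (R : Rooting T)

/-! ### Drawing terminal vertices in opposite pairs -/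

theorem not_isTerminal_par {v : V} (hv : v ≠ R.root) : ¬ R.IsTerminal (R.par v) :=
  fun h => h.2 v hv rfl

open Classical in
/-- The vertex at the centre of the box in which `v` is drawn: the parent if `v` is terminal, and
`v` itself otherwise. -/
noncomputable def centre (v : V) : V := if R.IsTerminal v then R.par v else v

theorem centre_of_isTerminal {l : V} (hl : R.IsTerminal l) : R.centre l = R.par l := if_pos hl

theorem centre_of_not_isTerminal {v : V} (hv : ¬ R.IsTerminal v) : R.centre v = v := if_neg hv

variable [Fintype V]

open Classical in
/-- The terminal children of `v`. -/
noncomputable def leaves (v : V) : Finset V := {l ∈ R.terminals | R.par l = v}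

/-- The number of terminal children of `v`. -/
noncomputable def leafCount (v : V) : ℕ := (R.leaves v).card

variable {R} in
theorem mem_terminals {v : V} : v ∈ R.terminals ↔ R.IsTerminal v := by simp [terminals]

variable {R} in
theorem mem_leaves {l v : V} : l ∈ R.leaves v ↔ R.IsTerminal l ∧ R.par l = v := by
  simp [leaves, mem_terminals]

theorem exists_leafEnum (v : V) : ∃ f : V → ℕ, Set.InjOn f (R.leaves v) ∧
    ∀ j, j < R.leafCount v ↔ ∃ l ∈ R.leaves v, f l = j := by
  classical
  refine ⟨fun l => if h : l ∈ R.leaves v then (R.leaves v).equivFin ⟨l, h⟩ else 0, ?_, ?_⟩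
  · intro a ha b hb hab
    have ha' : a ∈ R.leaves v := ha
    have hb' : b ∈ R.leaves v := hb
    simp only [ha', hb', dif_pos] at hab
    exact congrArg Subtype.val ((R.leaves v).equivFin.injective (Fin.ext hab))
  · intro j
    constructor
    · intro hj
      refine ⟨(R.leaves v).equivFin.symm ⟨j, hj⟩, Subtype.coe_prop _, ?_⟩
      simp
    · rintro ⟨l, hl, rfl⟩
      simp only [hl, dif_pos]
      exact Fin.is_lt _

/-- An enumeration of the terminal children of `v`, starting at `0`. -/
noncomputable def leafEnum (v : V) : V → ℕ := Classical.choose (R.exists_leafEnum v)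

theorem leafEnum_injOn (v : V) : Set.InjOn (R.leafEnum v) (R.leaves v) :=
  (Classical.choose_spec (R.exists_leafEnum v)).1

/-- The position of the terminal vertex `l` in the enumeration of the terminal children of its
parent. -/
noncomputable def leafIndex (l : V) : ℕ := R.leafEnum (R.par l) l

theorem lt_leafCount_iff {v : V} {j : ℕ} :
    j < R.leafCount v ↔ ∃ l ∈ R.leaves v, R.leafIndex l = j := by
  rw [(Classical.choose_spec (R.exists_leafEnum v)).2]
  refine exists_congr fun l => and_congr_right fun hl => ?_
  rw [leafIndex, (mem_leaves.1 hl).2, leafEnum]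

theorem leafIndex_injective {a b : V} (ha : R.IsTerminal a) (hb : R.IsTerminal b)
    (hp : R.par a = R.par b) (h : R.leafIndex a = R.leafIndex b) : a = b := by
  refine R.leafEnum_injOn (R.par b)
    (mem_leaves.2 ⟨ha, hp⟩) (mem_leaves.2 ⟨hb, rfl⟩) ?_
  rw [leafIndex, leafIndex, hp] at h
  exact h

theorem leafIndex_lt {l : V} (hl : R.IsTerminal l) : R.leafIndex l < R.leafCount (R.par l) :=
  R.lt_leafCount_iff.2 ⟨l, mem_leaves.2 ⟨hl, rfl⟩, rfl⟩

/-- The weight giving a vertex `v` room for its terminal children above and below it. -/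
noncomputable def leafWeight (v : V) : ℕ := 2 * R.leafCount v + 1

/-- The height of `v`, in the middle of the interval reserved for it. -/
noncomputable def height (v : V) : ℕ := R.offset R.leafWeight v + R.leafCount v

theorem subtreeWeight_leafWeight (v : V) :
    2 * R.leafCount v + 1 ≤ R.subtreeWeight R.leafWeight v :=
  R.le_subtreeWeight R.leafWeight v

theorem height_add_le_of_offset_add_le {u v : V}
    (h : R.offset R.leafWeight u + R.subtreeWeight R.leafWeight u ≤ R.offset R.leafWeight v) :
    R.height u + R.leafCount u + R.leafCount v + 1 ≤ R.height v := by
  have := R.subtreeWeight_leafWeight u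
  unfold height
  omega

theorem height_add_le_or {u v : V} (hd : R.depth u = R.depth v) (hne : u ≠ v) :
    R.height u + R.leafCount u + R.leafCount v + 1 ≤ R.height v ∨
      R.height v + R.leafCount v + R.leafCount u + 1 ≤ R.height u :=
  (R.offset_add_le_or R.leafWeight hd hne).imp R.height_add_le_of_offset_add_le
    R.height_add_le_of_offset_add_le

theorem height_injective_of_depth_eq {u v : V} (hd : R.depth u = R.depth v)
    (h : R.height u = R.height v) : u = v := by
  by_contra hne
  rcases R.height_add_le_or hd hne with h' | h' <;> omega

theorem height_par_le {u v : V} (hu : u ≠ R.root) (hv : v ≠ R.root) (hd : R.depth u = R.depth v)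
    (h : R.height u < R.height v) : R.height (R.par u) ≤ R.height (R.par v) := by
  have hne : u ≠ v := by rintro rfl; exact lt_irrefl _ h
  rcases R.offset_add_le_or R.leafWeight hd hne with h' | h'
  · rcases R.offset_par_of_offset_add_le
      (fun v _ => (Nat.succ_pos _).trans_le (R.subtreeWeight_leafWeight v)) hu hv hd h' with hp | hp
    · rw [hp]
    · have := R.height_add_le_of_offset_add_le hp
      omega
  · have := R.height_add_le_of_offset_add_le h'
    omega

open Classical in
/-- The vertices that are not terminal. -/
noncomputable def internals : Finset V := {v | ¬ R.IsTerminal v}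

variable {R} in
theorem mem_internals {v : V} : v ∈ R.internals ↔ ¬ R.IsTerminal v := by simp [internals]

theorem card_terminals_add_card_internals :
    R.terminals.card + R.internals.card = Fintype.card V := by
  classical
  exact Finset.card_filter_add_card_filter_not _

theorem sum_leafCount_internals : ∑ v ∈ R.internals, R.leafCount v = R.terminals.card := by
  classical
  rw [Finset.card_eq_sum_card_fiberwise (f := R.par) (t := R.internals)]
  · rfl
  · intro l hl
    exact mem_internals.2 (R.not_isTerminal_par (mem_terminals.1 hl).1)

theorem sum_leafCount : ∑ v, R.leafCount v = R.terminals.card := by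
  classical
  rw [Finset.card_eq_sum_card_fiberwise (f := R.par) (t := Finset.univ)]
  · rfl
  · intro l _
    exact Finset.mem_coe.2 (Finset.mem_univ _)

/-- The horizontal distance of consecutive layers. It exceeds every difference of heights, so that
edges between layers have slope less than `1` in absolute value. -/
def layerWidth (_R : Rooting T) : ℕ := 3 * Fintype.card V

theorem height_add_lt (v : V) : R.height v + R.leafCount v < R.layerWidth := by
  have h1 := R.offset_add_le R.leafWeight v
  have h2 := R.subtreeWeight_leafWeight v
  have h3 : ∑ u, R.leafWeight u = 2 * R.terminals.card + Fintype.card V := by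
    simp only [leafWeight, Finset.sum_add_distrib, ← Finset.mul_sum, R.sum_leafCount]
    simp
  have h4 := R.card_terminals_add_card_internals
  unfold height layerWidth
  omega

theorem leafCount_le_height (v : V) : R.leafCount v ≤ R.height v := Nat.le_add_left _ _

open Classical in
/-- The displacement of `v` from the centre of its box. The terminal children number `2 * j` and
`2 * j + 1` get the opposite vectors `(1, j + 1)` and `(-1, -(j + 1))`. -/
noncomputable def displacement (v : V) : ℤ × ℤ :=
  if R.IsTerminal v then
    if Even (R.leafIndex v) then (1, (R.leafIndex v / 2 + 1 : ℕ))
    else (-1, -(R.leafIndex v / 2 + 1 : ℕ))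
  else 0

/-- Non-terminal vertices are placed on vertical layers given by the depth, terminal vertices
next to their parents. -/
noncomputable def fanPos (v : V) : ℤ × ℤ :=
  (((R.layerWidth * R.depth (R.centre v) + 1 : ℕ) : ℤ), (R.height (R.centre v) : ℤ)) +
    R.displacement v

theorem displacement_of_not_isTerminal {v : V} (hv : ¬ R.IsTerminal v) : R.displacement v = 0 :=
  if_neg hv

/-- The displacement of a terminal vertex is a sign times a vector `(1, k)` with `1 ≤ k`. -/
theorem exists_displacement_eq {l : V} (hl : R.IsTerminal l) :
    ∃ σ k : ℤ, (σ = 1 ∨ σ = -1) ∧ 1 ≤ k ∧ k ≤ R.leafCount (R.par l) ∧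
      R.displacement l = (σ, σ * k) := by
  have h := R.leafIndex_lt hl
  unfold displacement
  rw [if_pos hl]
  by_cases he : Even (R.leafIndex l)
  · refine ⟨1, (R.leafIndex l / 2 + 1 : ℕ), Or.inl rfl, by push_cast; omega, by omega, ?_⟩
    rw [if_pos he, one_mul]
  · refine ⟨-1, (R.leafIndex l / 2 + 1 : ℕ), Or.inr rfl, by push_cast; omega, by omega, ?_⟩
    rw [if_neg he, neg_one_mul]

theorem displacement_injective {a b : V} (ha : R.IsTerminal a) (hb : R.IsTerminal b)
    (hp : R.par a = R.par b) (h : R.displacement a = R.displacement b) : a = b := by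
  refine R.leafIndex_injective ha hb hp ?_
  unfold displacement at h
  rw [if_pos ha, if_pos hb] at h
  split_ifs at h with h1 h2 h2
  all_goals
    simp only [Prod.mk.injEq, Nat.even_iff] at h h1 h2
    omega

theorem fanPos_of_not_isTerminal {v : V} (hv : ¬ R.IsTerminal v) :
    R.fanPos v = (((R.layerWidth * R.depth v + 1 : ℕ) : ℤ), (R.height v : ℤ)) := by
  rw [fanPos, R.centre_of_not_isTerminal hv, R.displacement_of_not_isTerminal hv, add_zero]

theorem fanPos_of_isTerminal {l : V} (hl : R.IsTerminal l) :
    R.fanPos l = R.fanPos (R.par l) + R.displacement l := by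
  rw [R.fanPos_of_not_isTerminal (R.not_isTerminal_par hl.1), fanPos, R.centre_of_isTerminal hl]

/-- The box around `v` that contains the edges to the terminal children of `v`. -/
def InBox (v : V) (q : ℝ × ℝ) : Prop :=
  |q.1 - (R.layerWidth * R.depth v + 1)| ≤ 1 ∧ |q.2 - R.height v| ≤ R.leafCount v

theorem three_le_layerWidth (v : V) : (3 : ℝ) ≤ R.layerWidth := by
  have h : 0 < Fintype.card V := Fintype.card_pos_iff.2 ⟨v⟩
  have : 3 ≤ R.layerWidth := by unfold layerWidth; omega
  exact_mod_cast this

theorem layer_add_le {u v : V} (h : R.depth u < R.depth v) :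
    (R.layerWidth : ℝ) * R.depth u + R.layerWidth ≤ R.layerWidth * R.depth v := by
  have h1 := Nat.mul_le_mul_left R.layerWidth (Nat.succ_le_of_lt h)
  rw [Nat.succ_eq_add_one, mul_add, mul_one] at h1
  exact_mod_cast h1

variable {R} in
/-- The boxes are pairwise disjoint. -/
theorem InBox.eq {u v : V} {q : ℝ × ℝ} (hu : R.InBox u q) (hv : R.InBox v q) : u = v := by
  by_contra hne
  have h3 := R.three_le_layerWidth u
  have hu1 := abs_le.1 hu.1
  have hv1 := abs_le.1 hv.1
  rcases lt_trichotomy (R.depth u) (R.depth v) with hd | hd | hd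
  · linarith [R.layer_add_le hd]
  · have hu2 := abs_le.1 hu.2
    have hv2 := abs_le.1 hv.2
    rcases R.height_add_le_or hd hne with h | h
    · have h' : (R.height u : ℝ) + R.leafCount u + R.leafCount v + 1 ≤ R.height v := by
        exact_mod_cast h
      linarith
    · have h' : (R.height v : ℝ) + R.leafCount v + R.leafCount u + 1 ≤ R.height u := by
        exact_mod_cast h
      linarith
  · linarith [R.layer_add_le hd]

/-- The points of the edge to a terminal vertex `l`, where `σ` and `k` come from the displacement
of `l`. -/
theorem exists_of_mem_leaf_edge {l : V} (hl : R.IsTerminal l) {σ k : ℤ}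
    (hdisp : R.displacement l = (σ, σ * k)) {q : ℝ × ℝ}
    (hq : q ∈ edgeSegment R.fanPos (R.par l) l) :
    ∃ t : ℝ, 0 ≤ t ∧ t ≤ 1 ∧ q.1 = (R.layerWidth * R.depth (R.par l) + 1) + t * σ ∧
      q.2 = R.height (R.par l) + t * (σ * k) := by
  obtain ⟨t, ht0, ht1, hx, hy⟩ := mem_segment_toPlane_iff.1 hq
  rw [R.fanPos_of_isTerminal hl, hdisp, R.fanPos_of_not_isTerminal (R.not_isTerminal_par hl.1)]
    at hx hy
  push_cast [Prod.fst_add, Prod.snd_add] at hx hy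
  exact ⟨t, ht0, ht1, by rw [hx]; ring, by rw [hy]; ring⟩

theorem toPlane_fanPos_eq {v : V} (hv : ¬ R.IsTerminal v) {q : ℝ × ℝ}
    (hx : q.1 = R.layerWidth * R.depth v + 1) (hy : q.2 = R.height v) :
    q = toPlane (R.fanPos v) := by
  rw [R.fanPos_of_not_isTerminal hv]
  ext
  · simp [toPlane, hx]
  · simp [toPlane, hy]

theorem inBox_of_mem_leaf_edge {l : V} (hl : R.IsTerminal l) {q : ℝ × ℝ}
    (hq : q ∈ edgeSegment R.fanPos (R.par l) l) : R.InBox (R.par l) q := by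
  obtain ⟨σ, k, hσ, hk1, hk, hdisp⟩ := R.exists_displacement_eq hl
  obtain ⟨t, ht0, ht1, hx, hy⟩ := R.exists_of_mem_leaf_edge hl hdisp hq
  have hσ' : |(σ : ℝ)| = 1 := by rcases hσ with rfl | rfl <;> simp
  have hk' : (k : ℝ) ≤ R.leafCount (R.par l) := by exact_mod_cast hk
  have hk1' : (1 : ℝ) ≤ k := by exact_mod_cast hk1
  constructor
  · rw [hx, add_sub_cancel_left, abs_mul, hσ', mul_one, abs_of_nonneg ht0]
    exact ht1
  · rw [hy, add_sub_cancel_left, abs_mul, abs_mul, hσ', one_mul, abs_of_nonneg ht0,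
      abs_of_nonneg (by linarith)]
    nlinarith

theorem inBox_centre (v : V) : R.InBox (R.centre v) (toPlane (R.fanPos v)) := by
  by_cases hv : R.IsTerminal v
  · rw [R.centre_of_isTerminal hv]
    exact R.inBox_of_mem_leaf_edge hv (right_mem_segment _ _ _)
  · rw [R.centre_of_not_isTerminal hv, R.fanPos_of_not_isTerminal hv]
    constructor <;> simp [toPlane]

theorem fanPos_injective : Function.Injective R.fanPos := by
  intro u v h
  have hc : R.centre u = R.centre v :=
    InBox.eq (R.inBox_centre u) (by rw [h]; exact R.inBox_centre v)
  have hd : R.displacement u = R.displacement v := by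
    unfold fanPos at h
    rw [hc] at h
    exact add_left_cancel h
  have hne : ∀ l, R.IsTerminal l → R.displacement l ≠ 0 := by
    intro l hl h0
    obtain ⟨σ, k, hσ, -, -, hdisp⟩ := R.exists_displacement_eq hl
    rw [h0] at hdisp
    have := congrArg Prod.fst hdisp
    simp only [Prod.fst_zero] at this
    omega
  by_cases hu : R.IsTerminal u <;> by_cases hv : R.IsTerminal v
  · rw [R.centre_of_isTerminal hu, R.centre_of_isTerminal hv] at hc
    exact R.displacement_injective hu hv hc hd
  · exact absurd (hd.trans (R.displacement_of_not_isTerminal hv)) (hne u hu)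
  · exact absurd (hd.symm.trans (R.displacement_of_not_isTerminal hu)) (hne v hv)
  · rwa [R.centre_of_not_isTerminal hu, R.centre_of_not_isTerminal hv] at hc

theorem leaf_leaf_meet {a b : V} (ha : R.IsTerminal a) (hb : R.IsTerminal b) (hab : a ≠ b)
    {q : ℝ × ℝ} (hqa : q ∈ edgeSegment R.fanPos (R.par a) a)
    (hqb : q ∈ edgeSegment R.fanPos (R.par b) b) :
    R.par a = R.par b ∧ q = toPlane (R.fanPos (R.par a)) := by
  have hp := InBox.eq (R.inBox_of_mem_leaf_edge ha hqa) (R.inBox_of_mem_leaf_edge hb hqb)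
  refine ⟨hp, ?_⟩
  obtain ⟨σ, k, hσ, hk1, -, hda⟩ := R.exists_displacement_eq ha
  obtain ⟨σ', k', hσ', hk1', -, hdb⟩ := R.exists_displacement_eq hb
  obtain ⟨t, ht0, ht1, hx, hy⟩ := R.exists_of_mem_leaf_edge ha hda hqa
  obtain ⟨t', ht0', ht1', hx', hy'⟩ := R.exists_of_mem_leaf_edge hb hdb hqb
  rw [← hp] at hx' hy'
  have e1 : t * σ = t' * σ' := by linarith
  have e2 : t * (σ * k) = t' * (σ' * k') := by linarith
  by_cases ht : t = 0
  · subst ht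
    exact R.toPlane_fanPos_eq (R.not_isTerminal_par ha.1) (by rw [hx]; ring) (by rw [hy]; ring)
  -- The two displacements are positively proportional, hence equal.
  exfalso
  have htpos : 0 < t := lt_of_le_of_ne ht0 (Ne.symm ht)
  have hσσ : σ = σ' := by
    rcases hσ with rfl | rfl <;> rcases hσ' with rfl | rfl <;> push_cast at e1
    · rfl
    · linarith
    · linarith
    · rfl
  have hkk : k = k' := by
    have h1 : (t * σ) * ((k : ℝ) - k') = 0 := by
      have : t' * (σ' * k') = (t * σ) * k' := by rw [e1]; ring
      rw [this] at e2
      linarith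
    have hσ0 : (σ : ℝ) ≠ 0 := by rcases hσ with rfl | rfl <;> simp
    have h2 := (mul_eq_zero.1 h1).resolve_left (mul_ne_zero ht hσ0)
    have : (k : ℝ) = k' := by linarith
    exact_mod_cast this
  exact hab (R.displacement_injective ha hb hp (by rw [hda, hdb, hσσ, hkk]))

/-- An edge between layers meets the edge to a terminal vertex `l` at most in `R.par l`. -/
theorem leaf_inner_meet {l c : V} (hl : R.IsTerminal l) (hc : c ≠ R.root)
    (hcT : ¬ R.IsTerminal c) {q : ℝ × ℝ} (hql : q ∈ edgeSegment R.fanPos (R.par l) l)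
    (hqc : q ∈ edgeSegment R.fanPos (R.par c) c) :
    R.par l ∈ s(R.par c, c) ∧ q = toPlane (R.fanPos (R.par l)) := by
  have hbox := R.inBox_of_mem_leaf_edge hl hql
  have hl' := R.not_isTerminal_par hl.1
  obtain ⟨σ, k, hσ, hk1, -, hdisp⟩ := R.exists_displacement_eq hl
  obtain ⟨τ, hτ0, hτ1, hxl, hyl⟩ := R.exists_of_mem_leaf_edge hl hdisp hql
  obtain ⟨t, ht0, ht1, hx, hy⟩ := mem_segment_toPlane_iff.1 hqc
  rw [R.fanPos_of_not_isTerminal hcT, R.fanPos_of_not_isTerminal (R.not_isTerminal_par hc)] at hx hy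
  have hdc := R.depth_par c hc
  have hdc' : (R.depth c : ℝ) = R.depth (R.par c) + 1 := by exact_mod_cast hdc
  push_cast [hdc'] at hx hy
  have h3 := R.three_le_layerWidth c
  have hk1' : (1 : ℝ) ≤ k := by exact_mod_cast hk1
  set A : ℝ := (R.layerWidth : ℝ)
  set Δ : ℝ := R.height c - R.height (R.par c) with hΔ
  -- The slope of an edge between layers is less than one in absolute value.
  have hlt : ∀ v, (R.height v : ℝ) + 1 ≤ A := by
    intro v
    have := R.height_add_lt v
    have h' : R.height v + 1 ≤ R.layerWidth := by omega
    have h'' : (R.height v : ℝ) + 1 ≤ (R.layerWidth : ℝ) := by exact_mod_cast h'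
    exact h''
  have hΔ1 : Δ ≤ A - 1 := by
    have := hlt c
    have : (0 : ℝ) ≤ R.height (R.par c) := Nat.cast_nonneg _
    linarith
  have hΔ2 : -(A - 1) ≤ Δ := by
    have := hlt (R.par c)
    have : (0 : ℝ) ≤ R.height c := Nat.cast_nonneg _
    linarith
  have hx' : q.1 = A * R.depth (R.par c) + 1 + t * A := by rw [hx]; ring
  have hb1 := abs_le.1 hbox.1
  -- Near the end `z` of the edge, where `q - z = ± s (A, Δ)` with `s A ≤ 1`, the edge stays
  -- within vertical distance less than `1` of `z`, hence outside the other boxes of the layer.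
  have hfar : ∀ (z : V) (s : ℝ), 0 ≤ s → s * A ≤ 1 → R.depth (R.par l) = R.depth z →
      |q.2 - R.height z| = s * |Δ| → R.par l = z := by
    intro z s hs0 hs1 hd habs
    by_contra hne
    have h1 : s * |Δ| < 1 := by
      have : |Δ| ≤ A - 1 := abs_le.2 ⟨hΔ2, hΔ1⟩
      have h2 : s * |Δ| ≤ s * (A - 1) := mul_le_mul_of_nonneg_left this hs0
      rcases hs0.eq_or_lt with h | h
      · rw [← h]; simp
      · linarith
    rw [← habs] at h1
    have h2 := abs_lt.1 h1
    have h4 := abs_le.1 hbox.2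
    rcases R.height_add_le_or hd hne with h | h
    · have h' : (R.height (R.par l) : ℝ) + R.leafCount (R.par l) + R.leafCount z + 1 ≤
        R.height z := by exact_mod_cast h
      have : (0 : ℝ) ≤ R.leafCount z := Nat.cast_nonneg _
      linarith
    · have h' : (R.height z : ℝ) + R.leafCount z + R.leafCount (R.par l) + 1 ≤
        R.height (R.par l) := by exact_mod_cast h
      have : (0 : ℝ) ≤ R.leafCount z := Nat.cast_nonneg _
      linarith
  -- The direction `(1, k)` is steeper than `(A, Δ)`.
  have hsteep : ∀ s : ℝ, s * A = τ * σ → s * Δ = τ * (σ * k) → s = 0 := by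
    intro s h1 h2
    have h4 : s * (A * k - Δ) = 0 := by
      have : τ * (σ * k) = s * A * k := by rw [h1]; ring
      rw [this] at h2
      linarith
    have h5 : 0 < A * k - Δ := by nlinarith
    exact (mul_eq_zero.1 h4).resolve_right h5.ne'
  rcases lt_trichotomy (R.depth (R.par l)) (R.depth (R.par c)) with hd | hd | hd
  · exfalso
    have := R.layer_add_le hd
    have : 0 ≤ t * A := by positivity
    linarith
  · have hd' : (R.depth (R.par l) : ℝ) = R.depth (R.par c) := by exact_mod_cast hd
    have hz := hfar (R.par c) t ht0 (by rw [hd'] at hb1; linarith) hd (by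
      rw [hy, add_sub_cancel_left, abs_mul, abs_of_nonneg ht0])
    rw [hz] at hxl hyl
    have hs := hsteep t (by linarith) (by linarith)
    rw [hz]
    refine ⟨by simp, R.toPlane_fanPos_eq (hz ▸ hl') ?_ ?_⟩
    · rw [hx', hs]; ring
    · rw [hy, hs]; ring
  · rcases (Nat.succ_le_of_lt hd).eq_or_lt with hd2 | hd2
    · have hd3 : R.depth (R.par l) = R.depth c := by omega
      have hd' : (R.depth (R.par l) : ℝ) = R.depth (R.par c) + 1 := by
        rw [← hdc']; exact_mod_cast hd3
      have hy' : q.2 = R.height c - (1 - t) * Δ := by rw [hy, hΔ]; ring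
      have hz := hfar c (1 - t) (by linarith) (by rw [hd'] at hb1; linarith) hd3 (by
        rw [hy', sub_sub_cancel_left, abs_neg, abs_mul, abs_of_nonneg (by linarith : 0 ≤ 1 - t)])
      rw [hz] at hxl hyl
      rw [hdc'] at hxl
      have hs := hsteep (-(1 - t)) (by linarith) (by linarith)
      have ht : t = 1 := by linarith
      rw [hz]
      refine ⟨by simp, R.toPlane_fanPos_eq hcT ?_ ?_⟩
      · rw [hx', hdc', ht]; ring
      · rw [hy', ht]; ring
    · exfalso
      have := R.layer_add_le (u := c) (v := R.par l) (by omega)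
      rw [hdc'] at this
      have : t * A ≤ A := by nlinarith
      linarith

theorem isCrossingFree_fanPos : IsCrossingFree T R.fanPos := by
  refine R.isCrossingFree R.fanPos_injective ?_
  intro c d hc hd hcd q hq hq'
  by_cases hcT : R.IsTerminal c <;> by_cases hdT : R.IsTerminal d
  · obtain ⟨h1, h2⟩ := R.leaf_leaf_meet hcT hdT hcd hq hq'
    exact ⟨_, by simp, by simp [h1], h2⟩
  · obtain ⟨h1, h2⟩ := R.leaf_inner_meet hcT hd hdT hq hq'
    exact ⟨_, by simp, h1, h2⟩
  · obtain ⟨h1, h2⟩ := R.leaf_inner_meet hdT hc hcT hq' hq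
    exact ⟨_, h1, by simp, h2⟩
  · have hcP := R.not_isTerminal_par hc
    have hdP := R.not_isTerminal_par hd
    obtain ⟨t, ht0, ht1, hx, hy⟩ := mem_segment_toPlane_iff.1 hq
    obtain ⟨t', ht0', ht1', hx', hy'⟩ := mem_segment_toPlane_iff.1 hq'
    have hdc : (R.depth c : ℝ) = R.depth (R.par c) + 1 := by exact_mod_cast R.depth_par c hc
    have hdd : (R.depth d : ℝ) = R.depth (R.par d) + 1 := by exact_mod_cast R.depth_par d hd
    rw [R.fanPos_of_not_isTerminal hcT, R.fanPos_of_not_isTerminal hcP] at hx hy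
    rw [R.fanPos_of_not_isTerminal hdT, R.fanPos_of_not_isTerminal hdP] at hx' hy'
    have h3 := R.three_le_layerWidth c
    push_cast [hdc, hdd] at hx hy hx' hy'
    rcases R.layered_meet (y := fun v => (R.height v : ℤ)) (A := R.layerWidth) (by linarith)
      (fun u v h h' => R.height_injective_of_depth_eq h (by exact_mod_cast h'))
      (fun u v hu hv h h' => by exact_mod_cast R.height_par_le hu hv h (by exact_mod_cast h'))
      hc hd hcd ht0 ht1 ht0' ht1' (by linarith)
      (by push_cast; linarith) with ⟨h, -, hp⟩ | ⟨h, -, hp⟩ | ⟨h, -, hp⟩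
    · exact ⟨R.par c, by simp, by simp [hp], R.toPlane_fanPos_eq hcP
        (by rw [hx, h]; ring) (by rw [hy, h]; ring)⟩
    · exact ⟨c, by simp, by simp [hp], R.toPlane_fanPos_eq hcT
        (by rw [hx, h, hdc]; ring) (by rw [hy, h]; ring)⟩
    · exact ⟨R.par c, by simp, by simp [hp], R.toPlane_fanPos_eq hcP
        (by rw [hx, h]; ring) (by rw [hy, h]; ring)⟩

theorem onGrid_fanPos :
    OnGrid R.fanPos (3 * Fintype.card V ^ 2) (3 * Fintype.card V) := by
  intro v
  have hn : 0 < Fintype.card V := Fintype.card_pos_iff.2 ⟨v⟩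
  have h1 := R.depth_lt_card (R.centre v)
  have h2 := R.height_add_lt (R.centre v)
  have h3 := R.leafCount_le_height (R.centre v)
  have hx : R.layerWidth * R.depth (R.centre v) + 2 < 3 * Fintype.card V ^ 2 := by
    unfold layerWidth
    nlinarith
  have hx' : ((R.layerWidth * R.depth (R.centre v) : ℕ) : ℤ) + 2 <
      (3 * Fintype.card V ^ 2 : ℕ) := by exact_mod_cast hx
  have hpos : (0 : ℤ) ≤ ((R.layerWidth * R.depth (R.centre v) : ℕ) : ℤ) := Int.natCast_nonneg _
  have hW : R.layerWidth = 3 * Fintype.card V := rfl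
  by_cases hv : R.IsTerminal v
  · obtain ⟨σ, k, hσ, hk1, hk, hdisp⟩ := R.exists_displacement_eq hv
    rw [← R.centre_of_isTerminal hv] at hk
    simp only [fanPos, hdisp, Prod.fst_add, Prod.snd_add]
    rcases hσ with rfl | rfl <;> refine ⟨?_, ?_, ?_, ?_⟩ <;> omega
  · simp only [fanPos, R.displacement_of_not_isTerminal hv, add_zero]
    refine ⟨?_, ?_, ?_, ?_⟩ <;> omega

open Classical in
/-- The segment through `v` carrying the terminal children number `2 * j` and `2 * j + 1` of `v`.
It starts at `v` if only the first of them exists. -/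
noncomputable def pairSegment (v : V) (j : ℕ) : Set (ℝ × ℝ) :=
  segment ℝ (toPlane (R.fanPos v - if 2 * j + 1 < R.leafCount v then (1, (j : ℤ) + 1) else 0))
    (toPlane (R.fanPos v + (1, (j : ℤ) + 1)))

theorem displacement_of_leafIndex_eq_two_mul {l : V} (hl : R.IsTerminal l) {j : ℕ}
    (h : R.leafIndex l = 2 * j) : R.displacement l = (1, (j : ℤ) + 1) := by
  unfold displacement
  rw [if_pos hl, if_pos (by rw [h]; exact even_two_mul j), h]
  simp

theorem displacement_of_leafIndex_eq_two_mul_add_one {l : V} (hl : R.IsTerminal l) {j : ℕ}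
    (h : R.leafIndex l = 2 * j + 1) : R.displacement l = -(1, (j : ℤ) + 1) := by
  unfold displacement
  rw [if_pos hl, if_neg (by rw [h, Nat.not_even_iff_odd]; exact odd_two_mul_add_one j), h,
    show (2 * j + 1) / 2 = j by omega]
  simp

theorem fanPos_mem_pairSegment (v : V) (j : ℕ) :
    toPlane (R.fanPos v) ∈ R.pairSegment v j := by
  unfold pairSegment
  split_ifs
  · rw [mem_segment_toPlane_iff]
    refine ⟨1 / 2, by norm_num, by norm_num, ?_, ?_⟩
    · simp only [toPlane, Prod.fst_sub, Prod.fst_add]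
      push_cast; ring
    · simp only [toPlane, Prod.snd_sub, Prod.snd_add]
      push_cast; ring
  · rw [sub_zero]
    exact left_mem_segment _ _ _

theorem leaf_edge_subset_pairSegment {l : V} (hl : R.IsTerminal l) :
    edgeSegment R.fanPos (R.par l) l ⊆ R.pairSegment (R.par l) (R.leafIndex l / 2) := by
  refine (convex_segment _ _).segment_subset (R.fanPos_mem_pairSegment _ _) ?_
  rw [R.fanPos_of_isTerminal hl]
  rcases Nat.even_or_odd' (R.leafIndex l) with ⟨j, hj | hj⟩
  · rw [R.displacement_of_leafIndex_eq_two_mul hl hj, hj, show 2 * j / 2 = j by omega]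
    exact right_mem_segment _ _ _
  · rw [R.displacement_of_leafIndex_eq_two_mul_add_one hl hj, ← sub_eq_add_neg, hj,
      show (2 * j + 1) / 2 = j by omega]
    have := R.leafIndex_lt hl
    rw [hj] at this
    rw [if_pos this]
    exact left_mem_segment _ _ _

theorem pairSegment_subset {v : V} {j : ℕ} (hj : 2 * j < R.leafCount v) :
    R.pairSegment v j ⊆ drawnEdges T R.fanPos := by
  obtain ⟨a, ha, haj⟩ := R.lt_leafCount_iff.1 hj
  rw [mem_leaves] at ha
  have hpa : R.fanPos a = R.fanPos v + (1, (j : ℤ) + 1) := by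
    rw [R.fanPos_of_isTerminal ha.1, R.displacement_of_leafIndex_eq_two_mul ha.1 haj, ha.2]
  have hva : T.Adj v a := ha.2 ▸ R.adj_par ha.1.1
  unfold pairSegment
  rw [← hpa]
  split_ifs with h
  · obtain ⟨b, hb, hbj⟩ := R.lt_leafCount_iff.1 h
    rw [mem_leaves] at hb
    have hpb : R.fanPos b = R.fanPos v - (1, (j : ℤ) + 1) := by
      rw [R.fanPos_of_isTerminal hb.1, R.displacement_of_leafIndex_eq_two_mul_add_one hb.1 hbj,
        hb.2, sub_eq_add_neg]
    have hvb : T.Adj v b := hb.2 ▸ R.adj_par hb.1.1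
    rw [← hpb]
    intro q hq
    obtain ⟨t, ht0, ht1, hx, hy⟩ := mem_segment_toPlane_iff.1 hq
    rw [hpa, hpb] at hx hy
    simp only [Prod.fst_sub, Prod.fst_add, Prod.snd_sub, Prod.snd_add] at hx hy
    push_cast at hx hy
    -- The point lies on one of the two halves of the segment.
    rcases le_total t (1 / 2) with ht | ht
    · refine ⟨v, b, hvb, mem_segment_toPlane_iff.2 ⟨1 - 2 * t, by linarith, by linarith, ?_, ?_⟩⟩
      · rw [hx, hpb]
        simp only [Prod.fst_sub]
        push_cast; ring
      · rw [hy, hpb]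
        simp only [Prod.snd_sub]
        push_cast; ring
    · refine ⟨v, a, hva, mem_segment_toPlane_iff.2 ⟨2 * t - 1, by linarith, by linarith, ?_, ?_⟩⟩
      · rw [hx, hpa]
        simp only [Prod.fst_add]
        push_cast; ring
      · rw [hy, hpa]
        simp only [Prod.snd_add]
        push_cast; ring
  · rw [sub_zero]
    exact fun q hq => ⟨v, a, hva, hq⟩

theorem exists_pairSegment_eq (v : V) (j : ℕ) :
    ∃ a b : ℝ × ℝ, a ≠ b ∧ R.pairSegment v j = segment ℝ a b := by
  refine ⟨_, _, ?_, rfl⟩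
  intro h
  have h1 := congrArg Prod.fst h
  simp only [toPlane, Int.cast_inj, Prod.fst_sub, Prod.fst_add] at h1
  split_ifs at h1
  · simp only at h1; omega
  · simp only [Prod.fst_zero] at h1; omega

/-- Each edge between non-terminal vertices gets its own segment, and the terminal children of each
vertex are grouped into pairs. The hypothesis on `k` comes from `⌈m / 2⌉ ≤ (m + 1) / 2`, summed over
the non-terminal vertices. -/
theorem usesAtMostSegments_fanPos {k : ℕ}
    (hk : 3 * Fintype.card V ≤ 2 * k + 2 * R.terminals.card + 3) :
    UsesAtMostSegments T R.fanPos k := by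
  classical
  have hroot : R.root ∈ R.internals := mem_internals.2 fun h => h.1 rfl
  refine ⟨(R.internals.erase R.root).image (fun c => edgeSegment R.fanPos (R.par c) c) ∪
    R.internals.biUnion (fun v =>
      (Finset.range ((R.leafCount v + 1) / 2)).image (R.pairSegment v)), ?_, ?_, ?_⟩
  · have h1 := Finset.card_union_le
      ((R.internals.erase R.root).image (fun c => edgeSegment R.fanPos (R.par c) c))
      (R.internals.biUnion (fun v =>
        (Finset.range ((R.leafCount v + 1) / 2)).image (R.pairSegment v)))
    have h2 := (R.internals.erase R.root).card_image_le
      (f := fun c => edgeSegment R.fanPos (R.par c) c)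
    rw [Finset.card_erase_of_mem hroot] at h2
    have h3 : (R.internals.biUnion (fun v =>
        (Finset.range ((R.leafCount v + 1) / 2)).image (R.pairSegment v))).card ≤
        ∑ v ∈ R.internals, (R.leafCount v + 1) / 2 := by
      refine Finset.card_biUnion_le.trans (Finset.sum_le_sum fun v _ => ?_)
      exact Finset.card_image_le.trans (Finset.card_range _).le
    have h4 : 2 * ∑ v ∈ R.internals, (R.leafCount v + 1) / 2 ≤
        R.terminals.card + R.internals.card := by
      rw [← R.sum_leafCount_internals, Finset.card_eq_sum_ones, ← Finset.sum_add_distrib,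
        Finset.mul_sum]
      exact Finset.sum_le_sum fun v _ => by omega
    have h5 := R.card_terminals_add_card_internals
    have h6 := Finset.card_pos.2 ⟨_, hroot⟩
    omega
  · intro s hs
    rcases Finset.mem_union.1 hs with hs | hs
    · obtain ⟨c, hc, rfl⟩ := Finset.mem_image.1 hs
      have hcr := Finset.ne_of_mem_erase hc
      refine ⟨fun q hq => ⟨_, _, R.adj_par hcr, hq⟩, _, _, ?_, rfl⟩
      intro h
      simp only [toPlane, Prod.mk.injEq, Int.cast_inj] at h
      exact R.par_ne hcr (R.fanPos_injective (Prod.ext h.1 h.2))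
    · obtain ⟨v, -, hs⟩ := Finset.mem_biUnion.1 hs
      obtain ⟨j, hj, rfl⟩ := Finset.mem_image.1 hs
      rw [Finset.mem_range] at hj
      exact ⟨R.pairSegment_subset (by omega), R.exists_pairSegment_eq v j⟩
  · intro x y hxy
    obtain ⟨c, hc, he⟩ := R.exists_edge_eq hxy
    have hseg : edgeSegment R.fanPos x y = edgeSegment R.fanPos (R.par c) c := by
      rcases Sym2.eq_iff.1 he with ⟨rfl, rfl⟩ | ⟨rfl, rfl⟩
      · rfl
      · exact edgeSegment_symm _ _ _
    rw [hseg]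
    by_cases hcT : R.IsTerminal c
    · refine ⟨_, Finset.mem_union_right _ (Finset.mem_biUnion.2 ⟨R.par c,
        mem_internals.2 (R.not_isTerminal_par hc), Finset.mem_image_of_mem _ ?_⟩),
        R.leaf_edge_subset_pairSegment hcT⟩
      have := R.leafIndex_lt hcT
      rw [Finset.mem_range]
      omega
    · exact ⟨_, Finset.mem_union_left _ (Finset.mem_image_of_mem _
        (Finset.mem_erase.2 ⟨hc, mem_internals.2 hcT⟩)), subset_rfl⟩

end Rooting

/-! ### Choosing between the two drawings -/

theorem UsesAtMostSegments.mono {V : Type*} {G : SimpleGraph V} {p : V → ℤ × ℤ} {k m : ℕ}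
    (h : UsesAtMostSegments G p k) (hkm : k ≤ m) : UsesAtMostSegments G p m := by
  obtain ⟨S, hS, h'⟩ := h
  exact ⟨S, hS.trans hkm, h'⟩

end GridDrawing

theorem mainTheorem3 :
    ∃ W H : ℕ → ℕ,
      (fun n : ℕ => (W n : ℝ)) =O[Filter.atTop] (fun n : ℕ => (n : ℝ) ^ 2) ∧
      (fun n : ℕ => (H n : ℝ)) =O[Filter.atTop] (fun n : ℕ => (n : ℝ) ^ (1.58 : ℝ)) ∧
      ∀ (V : Type*) [Finite V] (T : SimpleGraph V), T.IsTree →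
        ∃ p : V → ℤ × ℤ,
          GridDrawing.IsCrossingFree T p ∧
          GridDrawing.OnGrid p (W (Nat.card V)) (H (Nat.card V)) ∧
          GridDrawing.UsesAtMostSegments T p ⌈3 * (T.edgeSet.ncard : ℚ) / 4⌉₊ := by
  refine ⟨fun n => 3 * n ^ 2, fun n => 3 * n, ?_, ?_, ?_⟩
  · refine Asymptotics.IsBigO.of_bound 3 (Filter.Eventually.of_forall fun n => ?_)
    simp
  · refine Asymptotics.IsBigO.of_bound 3 (Filter.eventually_atTop.2 ⟨1, fun n hn => ?_⟩)
    have hn' : (1 : ℝ) ≤ n := by exact_mod_cast hn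
    have h := Real.rpow_le_rpow_of_exponent_le hn' (by norm_num : (1 : ℝ) ≤ 1.58)
    rw [Real.rpow_one] at h
    rw [Real.norm_of_nonneg (by positivity), Real.norm_of_nonneg (by positivity)]
    push_cast
    linarith
  · intro V _ T hT
    classical
    have := Fintype.ofFinite V
    obtain ⟨R⟩ := GridDrawing.exists_rooting hT
    have hcard : T.edgeSet.ncard + 1 = Fintype.card V := by
      rw [← hT.card_edgeFinset, ← SimpleGraph.coe_edgeFinset, Set.ncard_coe_finset]
    have hceil : 3 * T.edgeSet.ncard ≤ 4 * ⌈3 * (T.edgeSet.ncard : ℚ) / 4⌉₊ := by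
      have h := Nat.le_ceil (3 * (T.edgeSet.ncard : ℚ) / 4)
      have h' : 3 * (T.edgeSet.ncard : ℚ) ≤ 4 * (⌈3 * (T.edgeSet.ncard : ℚ) / 4⌉₊ : ℚ) := by
        linarith
      exact_mod_cast h'
    rw [Nat.card_eq_fintype_card]
    by_cases hl : R.terminals.card ≤ ⌈3 * (T.edgeSet.ncard : ℚ) / 4⌉₊
    · exact ⟨R.chainPos, R.isCrossingFree_chainPos, R.onGrid_chainPos,
        R.usesAtMostSegments_chainPos.mono hl⟩
    · refine ⟨R.fanPos, R.isCrossingFree_fanPos, R.onGrid_fanPos, R.usesAtMostSegments_fanPos ?_⟩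
      omega
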